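/- Let $\psi=\Gamma'/\Gamma$ be the digamma function, $\zeta$ the Riemann zeta function, and for $n\ge 0$ let $$Y_n(x_1,\dots,x_n)=\sum_{k_1+2k_2+\cdots+nk_n=n}\frac{n!}{k_1!\,k_2!\cdots k_n!}\left(\frac{x_1}{1!}\right)^{k_1}\left(\frac{x_2}{2!}\right)^{k_2}\cdots\left(\frac{x_n}{n!}\right)^{k_n}$$ (the sum being over non-negative integers $k_1,\dots,k_n$) be the exponential complete Bell polynomial, so that $Y_0=1$. Put $x_j=[(-1)^{j-1}-1]\,\psi^{(j-1)}(1)$ for $j\ge 1$, and write $\mathbf{Y}_k(\boldsymbol\psi(0))=Y_k(x_1,\dots,x_k)$ and $\mathbf{Y}_k(-\boldsymbol\psi(0))=Y_k(-x_1,\dots,-x_k)$. Then, for all $k\ge 0$, $$\mathbf{Y}_k(\boldsymbol\psi(0))=Y_k(z_1,\dots,z_k),\qquad \mathbf{Y}_k(-\boldsymbol\psi(0))=Y_k(-z_1,\dots,-z_k),$$ where $z_j=[(-1)^{j+1}-1]\,\zeta(j)\,(j-1)!$ for $j\ge 2$ and $z_1=0$. The integrals $$I_m=\int_0^\infty\left[\log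 u-\psi(1+u)+\frac{1}{2(1+u)}\right]\log^m u\,du\qquad(m\ge 0)$$ converge absolutely, and for every integer $n\ge 1$ $$\zeta^{(n)}(0)=n(-1)^n\sum_{k=0}^{n-1}\binom{n-1}{k}(-1)^{k+1}\,\mathbf{Y}_k(\boldsymbol\psi(0))\,I_{n-k-1}\tag{1.16}$$ and $$\sum_{k=0}^{n-1}\binom{n}{k}\zeta^{(n-k)}(0)\,\mathbf{Y}_k(-\boldsymbol\psi(0))=n(-1)^{n-1}I_{n-1}.\tag{1.16.1}$$ -/

import Mathlib

noncomputable section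

namespace ConnonZeta

/-- The (exponential) complete Bell polynomial `Y_n(x_1, …, x_n)`, evaluated at a sequence `x`
(only the entries `x 1, …, x n` matter): the sum runs over the partitions `p` of `n`, and
`p.parts.count j` is the number `k_j` of parts equal to `j`. In particular `Y_0 = 1`. -/
def completeBell (n : ℕ) (x : ℕ → ℂ) : ℂ :=
  ∑ p : Nat.Partition n,
    ((n.factorial : ℂ) / ∏ j ∈ Finset.Icc 1 n, ((p.parts.count j).factorial : ℂ)) *
      ∏ j ∈ Finset.Icc 1 n, (x j / (j.factorial : ℂ)) ^ p.parts.count j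

/-- The sequence `ψ(s)`, whose `j`-th entry (`j ≥ 1`) is
`(-1)^(j-1) ψ^{(j-1)}(1 - s) - ψ^{(j-1)}(1 + s)`, with `ψ` the digamma function. -/
def psiSeq (s : ℂ) (j : ℕ) : ℂ :=
  (-1) ^ (j - 1) * iteratedDeriv (j - 1) Complex.digamma (1 - s) -
    iteratedDeriv (j - 1) Complex.digamma (1 + s)

/-- The sequence whose `j`-th entry (`j ≥ 1`) is `[(-1)^(j+1) - 1] ζ(j) (j-1)!`. For `j = 1` the
bracket vanishes and the entry is `0`. -/
def zetaSeq (j : ℕ) : ℂ :=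
  ((-1) ^ (j + 1) - 1) * riemannZeta (j : ℂ) * ((j - 1).factorial : ℂ)

/-- The integrand `[log u - ψ(1+u) + 1/(2(1+u))] log^m u`, for `u > 0`. -/
def integrand (m : ℕ) (u : ℝ) : ℂ :=
  ((Real.log u : ℂ) - Complex.digamma (1 + (u : ℂ)) + 1 / (2 * (1 + (u : ℂ)))) *
    (Real.log u : ℂ) ^ m

end ConnonZeta

end

/-! Let M be the Mellin transform of `integrand 0`. Everything follows from one identity on the
strip |Re s| < 1 (`mul_mellin_integrand_zero`): s M(1 - s) = P(s) (ζ(s) + 1/2), where P(s) = Γ(1 -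
s) Γ(1 + s).

To obtain it, Binet's formula writes `integrand 0` as the Laplace transform of K(t) = 1/(e^t - 1) -
1/t + e^(-t)/2. Fubini then gives M(1 - s) = Γ(1 - s) K̃(s), with K̃ the Mellin transform of K, and
analytic continuation of the classical integral for Γ(s) ζ(s) gives s K̃(s) = Γ(1 + s) (ζ(s) + 1/2).

Now compare derivatives at 0. Those of M(1 - s) are (-1)^m I_m, since each derivative of a Mellin
transform inserts a logarithm. With h(s) = ψ(1 - s) - ψ(1 + s), P' = -hP and (1/P)' = h/P, with
value 1 at 0, so the derivatives of P and 1/P are complete Bell polynomials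
(`iteratedDeriv_eq_completeBell`). Leibniz' rule applied to the identity, divided by P or not, gives
the two formulas. The zeta values enter through h(s) = π cot(πs) - 1/s, expanded in powers of s. -/

namespace ConnonZeta

/-! ### Complete Bell polynomials: recurrence and the equation F' = hF. -/

open Finset

/-- The weight of a partition in the complete Bell polynomial, with normalized variables. -/
noncomputable def partitionWeight (a : ℕ → ℂ) (m : Multiset ℕ) (n : ℕ) : ℂ :=
  ∏ j ∈ Icc 1 n, a j ^ m.count j / ((m.count j).factorial : ℂ)

/-- The complete Bell polynomial divided by `n!`. -/
noncomputable def normalizedBell (a : ℕ → ℂ) (n : ℕ) : ℂ :=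
  ∑ p : Nat.Partition n, partitionWeight a p.parts n

lemma completeBell_eq_factorial_mul (n : ℕ) (x : ℕ → ℂ) :
    completeBell n x = n.factorial * normalizedBell (fun j => x j / j.factorial) n := by
  rw [completeBell, normalizedBell, mul_sum]
  refine sum_congr rfl fun p _ => ?_
  rw [partitionWeight, prod_div_distrib]
  ring

lemma completeBell_zero (x : ℕ → ℂ) : completeBell 0 x = 1 := by
  simp [completeBell]

lemma completeBell_congr {n : ℕ} {x y : ℕ → ℂ} (h : ∀ j, 1 ≤ j → x j = y j) :
    completeBell n x = completeBell n y := by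
  refine sum_congr rfl fun p _ => ?_
  congr 1
  refine prod_congr rfl fun j hj => ?_
  rw [h j (mem_Icc.1 hj).1]

lemma partitionWeight_of_le (a : ℕ → ℂ) {m : Multiset ℕ} {k n : ℕ} (hkn : k ≤ n)
    (hm : ∀ i ∈ m, i ≤ k) : partitionWeight a m n = partitionWeight a m k := by
  refine (prod_subset (Icc_subset_Icc_right hkn) fun j hj hj' => ?_).symm
  have : m.count j = 0 := by
    rw [Multiset.count_eq_zero]
    intro h
    exact hj' (mem_Icc.2 ⟨(mem_Icc.1 hj).1, hm j h⟩)
  simp [this]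

lemma partitionWeight_cons (a : ℕ → ℂ) (m : Multiset ℕ) {j n : ℕ} (hj : j ∈ Icc 1 n) :
    ((j ::ₘ m).count j : ℂ) * partitionWeight a (j ::ₘ m) n = a j * partitionWeight a m n := by
  rw [partitionWeight, partitionWeight, ← mul_prod_erase _ _ hj, ← mul_prod_erase _ _ hj]
  have : ∏ i ∈ (Icc 1 n).erase j, a i ^ (j ::ₘ m).count i / (((j ::ₘ m).count i).factorial : ℂ) =
      ∏ i ∈ (Icc 1 n).erase j, a i ^ m.count i / ((m.count i).factorial : ℂ) := by
    refine prod_congr rfl fun i hi => ?_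
    rw [Multiset.count_cons_of_ne (ne_of_mem_erase hi)]
  rw [this, ← mul_assoc, ← mul_assoc]
  congr 1
  rw [Multiset.count_cons_self, Nat.factorial_succ, pow_succ]
  have h1 : ((m.count j).factorial : ℂ) ≠ 0 := by exact_mod_cast Nat.factorial_ne_zero _
  have h2 : ((m.count j : ℂ) + 1) ≠ 0 := Nat.cast_add_one_ne_zero _
  push_cast
  field_simp

/-- Deleting one part `j` is a bijection from the partitions of `n` containing `j` to the partitions
of `n - j`; the other partitions have multiplicity factor zero. -/
lemma sum_count_mul_partitionWeight (a : ℕ → ℂ) {j n : ℕ} (hj : j ∈ Icc 1 n) :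
    ∑ p : Nat.Partition n, (p.parts.count j : ℂ) * partitionWeight a p.parts n =
      a j * normalizedBell a (n - j) := by
  obtain ⟨h1, h2⟩ := mem_Icc.1 hj
  rw [normalizedBell, mul_sum]
  have hz : ∀ p : Nat.Partition n, (p.parts.count j : ℂ) * partitionWeight a p.parts n ≠ 0 →
      j ∈ p.parts := by
    intro p hp
    by_contra h
    simp [Multiset.count_eq_zero.2 h] at hp
  rw [← sum_filter_of_ne fun p _ => hz p, ← sum_subtype_eq_sum_filter,
    Finset.subtype_univ, ← (Nat.Partition.partitionWithPartEquiv h1 h2).symm.sum_comp]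
  refine sum_congr rfl fun q _ => ?_
  rw [Nat.Partition.partitionWithPartEquiv_symm_apply_parts, partitionWeight_cons a _ hj,
    partitionWeight_of_le a (Nat.sub_le n j) fun i hi => q.le_of_mem_parts hi]

/-- The recurrence for the normalized Bell polynomials. -/
lemma mul_normalizedBell (a : ℕ → ℂ) (n : ℕ) :
    (n : ℂ) * normalizedBell a n = ∑ j ∈ Icc 1 n, j * a j * normalizedBell a (n - j) := by
  -- The size of a partition, counted by part value, distributes the factor `n` over the parts.
  have h (p : Nat.Partition n) : (n : ℂ) = ∑ j ∈ Icc 1 n, (j : ℂ) * p.parts.count j := by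
    have h1 : ∑ j ∈ Icc 1 n, p.parts.count j * j = n := by
      conv_rhs => rw [← p.parts_sum]
      rw [sum_multiset_count_of_subset p.parts (Icc 1 n)]
      · simp only [smul_eq_mul]
      intro i hi
      rw [Multiset.mem_toFinset] at hi
      exact mem_Icc.2 ⟨p.parts_pos hi, p.le_of_mem_parts hi⟩
    conv_lhs => rw [← h1]
    push_cast
    exact sum_congr rfl fun _ _ => mul_comm _ _
  rw [normalizedBell, mul_sum]
  calc _ = ∑ p : Nat.Partition n, ∑ j ∈ Icc 1 n,
        (j : ℂ) * (p.parts.count j * partitionWeight a p.parts n) := by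
        refine sum_congr rfl fun p _ => ?_
        conv_lhs => rw [h p, sum_mul]
        exact sum_congr rfl fun _ _ => by ring
    _ = _ := by
        rw [sum_comm]
        refine sum_congr rfl fun j hj => ?_
        rw [← mul_sum, sum_count_mul_partitionWeight a hj, mul_assoc]

/-- This is the recurrence that Leibniz' rule imposes on the derivatives of a solution of F' = hF.
-/
lemma completeBell_succ (n : ℕ) (x : ℕ → ℂ) :
    completeBell (n + 1) x =
      ∑ k ∈ range (n + 1), (n.choose k : ℂ) * x (k + 1) * completeBell (n - k) x := by
  have h := mul_normalizedBell (fun j => x j / j.factorial) (n + 1)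
  rw [completeBell_eq_factorial_mul, Nat.factorial_succ, Nat.cast_mul, mul_right_comm, h,
    sum_mul, ← Ico_add_one_right_eq_Icc, sum_Ico_eq_sum_range]
  refine sum_congr (by simp) fun k hk => ?_
  have hk' : k ≤ n := by simpa [Nat.lt_succ_iff] using hk
  rw [completeBell_eq_factorial_mul, add_comm 1 k, Nat.add_sub_add_right, Nat.factorial_succ,
    Nat.cast_choose ℂ hk']
  have h1 (i : ℕ) : (i.factorial : ℂ) ≠ 0 := by exact_mod_cast Nat.factorial_ne_zero _
  have h2 : (k : ℂ) + 1 ≠ 0 := Nat.cast_add_one_ne_zero _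
  have h3 := h1 k
  have h4 := h1 (n - k)
  push_cast
  field_simp

/-- Iterated derivatives of a solution of `F' = h F` are complete Bell polynomials in the
derivatives of `h`. -/
theorem iteratedDeriv_eq_completeBell {F h : ℂ → ℂ} {z : ℂ} (hF : AnalyticAt ℂ F z)
    (hh : AnalyticAt ℂ h z) (hz : F z = 1) (hd : deriv F =ᶠ[nhds z] h * F) (k : ℕ) :
    iteratedDeriv k F z = completeBell k (fun j => iteratedDeriv (j - 1) h z) := by
  induction k using Nat.strong_induction_on with
  | _ k ih =>
    cases k with
    | zero => simp [completeBell_zero, hz]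
    | succ n =>
      rw [iteratedDeriv_succ', hd.iteratedDeriv_eq, iteratedDeriv_mul hh.contDiffAt hF.contDiffAt,
        completeBell_succ]
      refine sum_congr rfl fun i hi => ?_
      rw [ih (n - i) (by omega)]
      simp

end ConnonZeta

/-! ### The product Γ(1 - s) Γ(1 + s) near 0 and the zeta values. -/

namespace ConnonZeta

open Complex Filter Topology

/-- The function `ψ(1 - s) - ψ(1 + s)`. -/
noncomputable def digammaDiff (s : ℂ) : ℂ := digamma (1 - s) - digamma (1 + s)

/-- The function `Γ(1 - s) Γ(1 + s)`. -/
noncomputable def gammaProd (s : ℂ) : ℂ := Gamma (1 - s) * Gamma (1 + s)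

lemma ne_neg_nat_of_re_pos {s : ℂ} (hs : 0 < s.re) (m : ℕ) : s ≠ -m := by
  rintro rfl
  simp only [neg_re, natCast_re] at hs
  have : (0 : ℝ) ≤ m := m.cast_nonneg
  linarith

lemma analyticAt_Gamma_of_re_pos {s : ℂ} (hs : 0 < s.re) : AnalyticAt ℂ Gamma s := by
  rw [analyticAt_iff_eventually_differentiableAt]
  filter_upwards [(continuous_re.isOpen_preimage _ isOpen_Ioi).mem_nhds hs] with z hz
  exact differentiableAt_Gamma z (ne_neg_nat_of_re_pos hz)

lemma analyticAt_digamma_of_re_pos {s : ℂ} (hs : 0 < s.re) : AnalyticAt ℂ digamma s :=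
  (analyticAt_Gamma_of_re_pos hs).deriv.div (analyticAt_Gamma_of_re_pos hs)
    (Gamma_ne_zero_of_re_pos hs)

lemma analyticAt_gammaProd {s : ℂ} (h1 : -1 < s.re) (h2 : s.re < 1) :
    AnalyticAt ℂ gammaProd s := by
  refine AnalyticAt.mul (AnalyticAt.fun_comp (analyticAt_Gamma_of_re_pos ?_) (by fun_prop))
    (AnalyticAt.fun_comp (analyticAt_Gamma_of_re_pos ?_) (by fun_prop)) <;> simp <;> linarith

lemma gammaProd_ne_zero {s : ℂ} (h1 : -1 < s.re) (h2 : s.re < 1) : gammaProd s ≠ 0 := by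
  refine mul_ne_zero (Gamma_ne_zero_of_re_pos ?_) (Gamma_ne_zero_of_re_pos ?_) <;>
    simp <;> linarith

lemma gammaProd_zero : gammaProd 0 = 1 := by simp [gammaProd]

lemma analyticAt_digammaDiff_zero : AnalyticAt ℂ digammaDiff 0 :=
  AnalyticAt.sub (AnalyticAt.fun_comp (analyticAt_digamma_of_re_pos (by simp)) (by fun_prop))
    (AnalyticAt.fun_comp (analyticAt_digamma_of_re_pos (by simp)) (by fun_prop))

lemma deriv_gammaProd {s : ℂ} (h1 : -1 < s.re) (h2 : s.re < 1) :
    deriv gammaProd s = -digammaDiff s * gammaProd s := by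
  have hp : 0 < (1 - s).re := by simp; linarith
  have hq : 0 < (1 + s).re := by simp; linarith
  have d1 := (analyticAt_Gamma_of_re_pos hp).differentiableAt
  have d2 := (analyticAt_Gamma_of_re_pos hq).differentiableAt
  have e1 := d1.hasDerivAt.comp s ((hasDerivAt_id s).const_sub 1)
  have e2 := d2.hasDerivAt.comp s ((hasDerivAt_id s).const_add 1)
  have := (e1.mul e2).deriv
  have g1 := Gamma_ne_zero_of_re_pos hp
  have g2 := Gamma_ne_zero_of_re_pos hq
  refine this.trans ?_
  simp only [digammaDiff, gammaProd, digamma, logDeriv_apply, Function.comp_apply]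
  field_simp
  ring

lemma eventually_re_mem_strip : ∀ᶠ s : ℂ in 𝓝 0, -1 < s.re ∧ s.re < 1 := by
  have h : IsOpen {s : ℂ | -1 < s.re ∧ s.re < 1} :=
    (isOpen_lt continuous_const continuous_re).inter (isOpen_lt continuous_re continuous_const)
  exact h.mem_nhds (by simp)

lemma psiSeq_zero_eq (j : ℕ) : psiSeq 0 j = iteratedDeriv (j - 1) digammaDiff 0 := by
  have h1 : ContDiffAt ℂ (j - 1 : ℕ) (fun s => digamma (1 - s)) 0 :=
    (AnalyticAt.fun_comp (analyticAt_digamma_of_re_pos (by simp)) (by fun_prop)).contDiffAt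
  have h2 : ContDiffAt ℂ (j - 1 : ℕ) (fun s => digamma (1 + s)) 0 :=
    (AnalyticAt.fun_comp (analyticAt_digamma_of_re_pos (by simp)) (by fun_prop)).contDiffAt
  have := iteratedDeriv_fun_sub h1 h2
  rw [iteratedDeriv_comp_const_sub, iteratedDeriv_comp_const_add] at this
  exact this.symm

theorem iteratedDeriv_gammaProd_zero (k : ℕ) :
    iteratedDeriv k gammaProd 0 = completeBell k (fun j => -psiSeq 0 j) := by
  rw [iteratedDeriv_eq_completeBell (h := -digammaDiff) (analyticAt_gammaProd (by simp) (by simp))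
    analyticAt_digammaDiff_zero.neg gammaProd_zero]
  · refine completeBell_congr fun j _ => ?_
    rw [psiSeq_zero_eq, iteratedDeriv_neg]
  · filter_upwards [eventually_re_mem_strip] with s hs
    exact deriv_gammaProd hs.1 hs.2

theorem iteratedDeriv_inv_gammaProd_zero (k : ℕ) :
    iteratedDeriv k gammaProd⁻¹ 0 = completeBell k (psiSeq 0) := by
  rw [iteratedDeriv_eq_completeBell (h := digammaDiff)
    ((analyticAt_gammaProd (by simp) (by simp)).inv (gammaProd_ne_zero (by simp) (by simp)))
    analyticAt_digammaDiff_zero (by simp [gammaProd_zero])]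
  · exact completeBell_congr fun j _ => (psiSeq_zero_eq j).symm
  · filter_upwards [eventually_re_mem_strip] with s hs
    have hne := gammaProd_ne_zero hs.1 hs.2
    rw [deriv_inv'' (analyticAt_gammaProd hs.1 hs.2).differentiableAt hne,
      deriv_gammaProd hs.1 hs.2, Pi.mul_apply, Pi.inv_apply]
    field_simp

lemma mem_integerComplement_of_norm_lt_one {s : ℂ} (h0 : s ≠ 0) (h1 : ‖s‖ < 1) :
    s ∈ integerComplement := by
  rw [mem_integerComplement_iff]
  rintro ⟨n, rfl⟩
  rw [norm_intCast, ← Int.cast_abs] at h1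
  have : |n| < 1 := by exact_mod_cast h1
  exact h0 (by simp [Int.abs_lt_one_iff.1 this])

/-- Euler's reflection formula. Nonzero integers need no exclusion: there both sides are 0 by the
conventions for Γ at its poles and for division. -/
lemma inv_gammaProd_eq {s : ℂ} (h0 : s ≠ 0) :
    (gammaProd s)⁻¹ = sin (Real.pi * s) / (Real.pi * s) := by
  rw [gammaProd, add_comm 1 s, Gamma_add_one s h0, mul_left_comm, mul_comm (Gamma (1 - s)),
    Gamma_mul_Gamma_one_sub, mul_inv, inv_div]
  field_simp

/-- Both sides are the logarithmic derivative of 1/P(s) = sin(πs)/(πs). -/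
lemma digammaDiff_eq_cot {s : ℂ} (h0 : s ≠ 0) (h1 : ‖s‖ < 1) :
    digammaDiff s = Real.pi * cot (Real.pi * s) - 1 / s := by
  have hs := mem_integerComplement_of_norm_lt_one h0 h1
  obtain ⟨hl, hr⟩ := abs_lt.1 ((abs_re_le_norm s).trans_lt h1)
  rw [← logDeriv_sin_div_eq_cot hs]
  have he : (fun t : ℂ => sin (Real.pi * t) / (Real.pi * t)) =ᶠ[𝓝 s] gammaProd⁻¹ := by
    filter_upwards [isOpen_ne.mem_nhds h0] with z hz
    exact (inv_gammaProd_eq hz).symm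
  have hne := gammaProd_ne_zero hl hr
  rw [logDeriv_apply, he.deriv_eq, he.eq_of_nhds,
    deriv_inv'' (analyticAt_gammaProd hl hr).differentiableAt hne,
    deriv_gammaProd hl hr, Pi.inv_apply]
  field_simp

/-- Two geometric series in ±s/(n+1); their difference cancels the even powers. -/
lemma hasSum_cotTerm {s : ℂ} (h1 : ‖s‖ < 1) (n : ℕ) :
    HasSum (fun m : ℕ => ((-1) ^ m - 1) * s ^ m / ((n : ℂ) + 1) ^ (m + 1)) (cotTerm s n) := by
  have hn : ((n : ℂ) + 1) ≠ 0 := Nat.cast_add_one_ne_zero n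
  have hn1 : ‖s / (n + 1)‖ < 1 := by
    rw [norm_div, div_lt_one (norm_pos_iff.2 hn)]
    refine h1.trans_le ?_
    have : ‖(n : ℂ) + 1‖ = n + 1 := by
      rw [← Nat.cast_add_one, norm_natCast, Nat.cast_add_one]
    rw [this]
    linarith [n.cast_nonneg (α := ℝ)]
  have ha := (hasSum_geometric_of_norm_lt_one hn1).mul_left (1 / ((n : ℂ) + 1))
  have hb := (hasSum_geometric_of_norm_lt_one (ξ := -(s / (n + 1))) (by rwa [norm_neg])).mul_left
    (1 / ((n : ℂ) + 1))
  have h3 : ((n : ℂ) + 1) - s ≠ 0 := by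
    intro h
    rw [← sub_eq_zero.1 h, div_self hn] at hn1
    simp at hn1
  have h4 : ((n : ℂ) + 1) + s ≠ 0 := by
    intro h
    rw [← neg_eq_of_add_eq_zero_right h, neg_div, norm_neg, div_self hn] at hn1
    simp at hn1
  have h5 : s - ((n : ℂ) + 1) ≠ 0 := by
    rw [← neg_sub]
    exact neg_ne_zero.2 h3
  convert! hb.sub ha using 1
  · ext m
    rw [neg_pow (s / ((n : ℂ) + 1)), div_pow, pow_succ]
    field_simp
  · rw [cotTerm, sub_neg_eq_add, one_add_div hn, one_sub_div hn, add_comm s, ← neg_sub, div_neg]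
    field_simp
    ring

/-- The column m = 0 vanishes, so every remaining term carries at least (n+1)^(-2). -/
lemma summable_digammaDiff_double {s : ℂ} (h1 : ‖s‖ < 1) :
    Summable (fun p : ℕ × ℕ => ((-1) ^ p.2 - 1) * s ^ p.2 / ((p.1 : ℂ) + 1) ^ (p.2 + 1)) := by
  have hz : Summable fun n : ℕ => 1 / ((n : ℝ) + 1) ^ 2 := by
    simpa using (summable_nat_add_iff 1).2 (Real.summable_one_div_nat_pow.2 one_lt_two)
  have hg := (summable_geometric_of_lt_one (norm_nonneg s) h1).mul_left 2
  refine Summable.of_norm_bounded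
    (hz.mul_of_nonneg hg (fun n => by positivity) (fun m => by positivity)) ?_
  rintro ⟨n, m⟩
  dsimp only
  rcases Nat.eq_zero_or_pos m with rfl | hm
  · simp
    positivity
  have hn : ‖(n : ℂ) + 1‖ = n + 1 := by
    rw [← Nat.cast_add_one, norm_natCast, Nat.cast_add_one]
  rw [norm_div, norm_mul, norm_pow, norm_pow, hn, one_div_mul_eq_div]
  gcongr
  · refine (norm_sub_le _ _).trans ?_
    rw [norm_pow, norm_neg, norm_one, one_pow]
    norm_num
  · linarith [n.cast_nonneg (α := ℝ)]
  · omega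

lemma hasSum_zetaSeq_term {s : ℂ} (m : ℕ) :
    HasSum (fun n : ℕ => ((-1) ^ m - 1) * s ^ m / ((n : ℂ) + 1) ^ (m + 1))
      (s ^ m * (zetaSeq (m + 1) / m.factorial)) := by
  have hf : (m.factorial : ℂ) ≠ 0 := by exact_mod_cast Nat.factorial_ne_zero _
  -- For m = 0 the bracket is zero, so the value of `riemannZeta` at its pole 1 is irrelevant.
  rcases Nat.eq_zero_or_pos m with rfl | hm
  · simp [zetaSeq, hasSum_zero]
  have hz : HasSum (fun n : ℕ => 1 / ((n : ℂ) + 1) ^ (m + 1)) (riemannZeta (m + 1 : ℕ)) := by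
    have h := zeta_eq_tsum_one_div_nat_add_one_cpow (s := (m + 1 : ℕ))
      (by rw [natCast_re]; exact_mod_cast Nat.succ_lt_succ hm)
    simp only [cpow_natCast] at h
    rw [h]
    refine Summable.hasSum ?_
    have := (summable_nat_add_iff 1).2
      (Complex.summable_one_div_nat_cpow (p := ((m + 1 : ℕ) : ℂ)).2
        (by rw [natCast_re]; exact_mod_cast Nat.succ_lt_succ hm))
    simp only [cpow_natCast] at this
    simpa only [Nat.cast_add_one] using this
  convert! hz.mul_left (((-1) ^ m - 1) * s ^ m) using 1
  · ext n
    rw [mul_one_div]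
  · rw [zetaSeq, Nat.add_sub_cancel, pow_add, pow_add]
    field_simp

theorem hasSum_digammaDiff {s : ℂ} (h1 : ‖s‖ < 1) :
    HasSum (fun m : ℕ => s ^ m * (zetaSeq (m + 1) / m.factorial)) (digammaDiff s) := by
  rcases eq_or_ne s 0 with rfl | h0
  · have : digammaDiff 0 = 0 := by simp [digammaDiff]
    rw [this]
    convert! hasSum_zero using 1
    ext m
    rcases Nat.eq_zero_or_pos m with rfl | hm
    · simp [zetaSeq]
    · simp [hm.ne']
  have hs := summable_digammaDiff_double h1
  have e : digammaDiff s = ∑' p : ℕ × ℕ,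
      ((-1) ^ p.2 - 1) * s ^ p.2 / ((p.1 : ℂ) + 1) ^ (p.2 + 1) := by
    rw [digammaDiff_eq_cot h0 h1, cot_series_rep' (mem_integerComplement_of_norm_lt_one h0 h1)]
    exact (hs.hasSum.prod_fiberwise fun n => hasSum_cotTerm h1 n).tsum_eq
  rw [e, ← (Equiv.prodComm ℕ ℕ).tsum_eq]
  exact ((Equiv.prodComm ℕ ℕ).summable_iff.2 hs).hasSum.prod_fiberwise
    fun m => hasSum_zetaSeq_term m

/-- Uniqueness of power series coefficients: Taylor's expansion against the cotangent expansion. -/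
theorem psiSeq_zero_eq_zetaSeq {j : ℕ} (hj : 1 ≤ j) : psiSeq 0 j = zetaSeq j := by
  obtain ⟨m, rfl⟩ := Nat.exists_eq_add_of_le' hj
  rw [psiSeq_zero_eq, Nat.add_sub_cancel]
  have h1 := analyticAt_digammaDiff_zero.hasFPowerSeriesAt
  have h2 : HasFPowerSeriesAt digammaDiff
      (FormalMultilinearSeries.ofScalars ℂ fun m : ℕ => zetaSeq (m + 1) / (m.factorial : ℂ)) 0 := by
    rw [hasFPowerSeriesAt_iff]
    filter_upwards [Metric.ball_mem_nhds (0 : ℂ) one_pos] with s hs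
    simpa using hasSum_digammaDiff (mem_ball_zero_iff.1 hs)
  have h3 := congrArg (fun p => p.coeff m) (h1.eq_formalMultilinearSeries h2)
  simp only [FormalMultilinearSeries.coeff_ofScalars] at h3
  have hf : (m.factorial : ℂ) ≠ 0 := by exact_mod_cast Nat.factorial_ne_zero _
  rwa [div_left_inj' hf] at h3

end ConnonZeta

/-! ### Binet's formula for log u - ψ(1 + u). -/

namespace ConnonZeta

open Filter Topology MeasureTheory Set

/-- The real digamma function, as the derivative of `log Γ`. -/
noncomputable def realDigamma (x : ℝ) : ℝ := deriv (Real.log ∘ Real.Gamma) x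

lemma differentiableAt_Gamma_of_pos {x : ℝ} (hx : 0 < x) : DifferentiableAt ℝ Real.Gamma x :=
  Real.differentiableAt_Gamma fun m => by
    have : (0 : ℝ) ≤ m := m.cast_nonneg
    linarith

lemma differentiableAt_logGamma {x : ℝ} (hx : 0 < x) :
    DifferentiableAt ℝ (Real.log ∘ Real.Gamma) x :=
  (differentiableAt_Gamma_of_pos hx).log (Real.Gamma_pos_of_pos hx).ne'

lemma logGamma_add_one {x : ℝ} (hx : 0 < x) :
    (Real.log ∘ Real.Gamma) (x + 1) = (Real.log ∘ Real.Gamma) x + Real.log x := by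
  simp only [Function.comp_apply, Real.Gamma_add_one hx.ne',
    Real.log_mul hx.ne' (Real.Gamma_pos_of_pos hx).ne', add_comm]

lemma digamma_ofReal {x : ℝ} (hx : 0 < x) : Complex.digamma x = (realDigamma x : ℂ) := by
  have h1 : HasDerivAt (fun y : ℝ => Complex.Gamma y) (deriv Complex.Gamma x) x :=
    (Complex.differentiableAt_Gamma x (ne_neg_nat_of_re_pos (by simpa using hx))).hasDerivAt.comp_ofReal
  have h2 : HasDerivAt (fun y : ℝ => ((Real.Gamma y : ℝ) : ℂ)) (deriv Real.Gamma x : ℝ) x :=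
    (differentiableAt_Gamma_of_pos hx).hasDerivAt.ofReal_comp
  simp only [Complex.Gamma_ofReal] at h1
  rw [Complex.digamma, logDeriv_apply, h1.unique h2, Complex.Gamma_ofReal, realDigamma,
    Function.comp_def, deriv.log (differentiableAt_Gamma_of_pos hx) (Real.Gamma_pos_of_pos hx).ne',
    Complex.ofReal_div]

lemma realDigamma_add_one {x : ℝ} (hx : 0 < x) :
    realDigamma (x + 1) = realDigamma x + 1 / x := by
  rw [realDigamma, realDigamma, ← deriv_comp_add_const, one_div, ← Real.deriv_log,
    ← deriv_fun_add (differentiableAt_logGamma hx) (Real.differentiableAt_log hx.ne')]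
  apply EventuallyEq.deriv_eq
  filter_upwards [eventually_gt_nhds hx] with y hy using logGamma_add_one hy

/-- The chord of the convex function log Γ over [x, x+1] has slope log x, which lies between the
derivatives at the two endpoints. The next lemma is the other half. -/
lemma log_le_realDigamma_add_one {x : ℝ} (hx : 0 < x) : Real.log x ≤ realDigamma (x + 1) := by
  have h := Real.convexOn_log_Gamma.slope_le_deriv (mem_Ioi.2 hx)
    (mem_Ioi.2 (by linarith : 0 < x + 1)) (by linarith) (differentiableAt_logGamma (by linarith))
  rwa [slope_def_field, add_sub_cancel_left, div_one, logGamma_add_one hx,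
    add_sub_cancel_left] at h

lemma realDigamma_le_log {x : ℝ} (hx : 0 < x) : realDigamma x ≤ Real.log x := by
  have h := Real.convexOn_log_Gamma.deriv_le_slope (mem_Ioi.2 hx)
    (mem_Ioi.2 (by linarith : 0 < x + 1)) (by linarith) (differentiableAt_logGamma hx)
  rwa [slope_def_field, add_sub_cancel_left, div_one, logGamma_add_one hx,
    add_sub_cancel_left] at h

lemma abs_log_sub_realDigamma_le {x : ℝ} (hx : 0 < x) :
    |Real.log x - realDigamma (x + 1)| ≤ 1 / x := by
  have h1 := log_le_realDigamma_add_one hx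
  have h2 := realDigamma_le_log (by linarith : 0 < x + 1)
  have h3 : Real.log (x + 1) - Real.log x ≤ 1 / x := by
    rw [← Real.log_div (by linarith) hx.ne']
    refine (Real.log_le_sub_one_of_pos (by positivity)).trans (le_of_eq ?_)
    field_simp
    ring
  rw [abs_le]
  constructor <;> linarith [one_div_pos.2 hx]

/-- The function `1 / (e ^ t - 1) - 1 / t`. -/
noncomputable def binetKernel (t : ℝ) : ℝ := 1 / (Real.exp t - 1) - 1 / t

lemma exp_sub_one_pos {t : ℝ} (ht : 0 < t) : 0 < Real.exp t - 1 := by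
  linarith [Real.add_one_lt_exp ht.ne']

lemma abs_binetKernel_le_one {t : ℝ} (ht : 0 < t) : |binetKernel t| ≤ 1 := by
  have he := exp_sub_one_pos ht
  have h1 := Real.add_one_le_exp t
  have h2 : binetKernel t ≤ 0 := by
    rw [binetKernel, sub_nonpos]
    exact one_div_le_one_div_of_le ht (by linarith)
  have h3 : -1 ≤ binetKernel t := by
    -- Cleared of denominators, the lower bound amounts to 1 - e^(-t) ≤ t.
    rw [binetKernel, neg_le_sub_iff_le_add, div_add' _ _ _ he.ne', div_le_div_iff₀ ht he]
    have h4 := Real.add_one_le_exp (-t)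
    have h5 : Real.exp (-t) * Real.exp t = 1 := by rw [← Real.exp_add]; simp
    nlinarith [Real.exp_pos t]
  exact abs_le.2 ⟨h3, h2.trans zero_le_one⟩

lemma continuousOn_binetKernel : ContinuousOn binetKernel (Ioi 0) := by
  unfold binetKernel
  refine ContinuousOn.sub (continuousOn_const.div (by fun_prop) ?_)
    (continuousOn_const.div continuousOn_id ?_)
  · exact fun t ht => (exp_sub_one_pos ht).ne'
  · exact fun t ht => (mem_Ioi.1 ht).ne'

lemma integrableOn_exp_neg_mul {u : ℝ} (hu : 0 < u) :
    IntegrableOn (fun t : ℝ => Real.exp (-(u * t))) (Ioi 0) := by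
  simpa only [neg_mul] using exp_neg_integrableOn_Ioi 0 hu

lemma integral_exp_neg_mul {u : ℝ} (hu : 0 < u) :
    ∫ t in Ioi (0 : ℝ), Real.exp (-(u * t)) = 1 / u := by
  have := integral_exp_mul_Ioi (neg_lt_zero.2 hu) 0
  simpa [neg_mul] using this

lemma integrableOn_exp_mul_binetKernel {u : ℝ} (hu : 0 < u) :
    IntegrableOn (fun t : ℝ => Real.exp (-(u * t)) * binetKernel t) (Ioi 0) := by
  refine Integrable.mono' (integrableOn_exp_neg_mul hu)
    (ContinuousOn.aestronglyMeasurable (ContinuousOn.mul (by fun_prop) continuousOn_binetKernel)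
      measurableSet_Ioi) ?_
  filter_upwards [ae_restrict_mem measurableSet_Ioi] with t ht
  rw [norm_mul, Real.norm_of_nonneg (Real.exp_pos _).le]
  exact mul_le_of_le_one_right (Real.exp_pos _).le (abs_binetKernel_le_one ht)

/-- The Laplace transform of the Binet kernel. -/
noncomputable def binetLaplace (u : ℝ) : ℝ :=
  ∫ t in Ioi (0 : ℝ), Real.exp (-(u * t)) * binetKernel t

lemma abs_binetLaplace_le {u : ℝ} (hu : 0 < u) : |binetLaplace u| ≤ 1 / u := by
  rw [← integral_exp_neg_mul hu, ← Real.norm_eq_abs]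
  refine norm_integral_le_of_norm_le (integrableOn_exp_neg_mul hu) ?_
  filter_upwards [ae_restrict_mem measurableSet_Ioi] with t ht
  rw [norm_mul, Real.norm_of_nonneg (Real.exp_pos _).le]
  exact mul_le_of_le_one_right (Real.exp_pos _).le (abs_binetKernel_le_one ht)

/-- Since e^(-ut) - e^(-(u+1)t) = e^(-(u+1)t) (e^t - 1), the first part of the kernel leaves a pure
exponential, and the part 1/t is a Frullani integral. -/
lemma binetLaplace_sub {u : ℝ} (hu : 0 < u) :
    binetLaplace u - binetLaplace (u + 1) = 1 / (u + 1) - Real.log ((u + 1) / u) := by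
  have hu1 : 0 < u + 1 := by linarith
  have hA := integrableOn_exp_mul_binetKernel hu
  have hB := integrableOn_exp_mul_binetKernel hu1
  have hC := integrableOn_exp_neg_mul hu1
  have key : EqOn (fun t : ℝ => t⁻¹ • (Real.exp (-(u * t)) - Real.exp (-((u + 1) * t))))
      (fun t => Real.exp (-((u + 1) * t)) -
        (Real.exp (-(u * t)) * binetKernel t - Real.exp (-((u + 1) * t)) * binetKernel t))
      (Ioi 0) := by
    intro t ht
    have ht' : t ≠ 0 := (mem_Ioi.1 ht).ne'
    have he := (exp_sub_one_pos ht).ne'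
    have h1 : Real.exp (-(u * t)) = Real.exp (-((u + 1) * t)) * Real.exp t := by
      rw [← Real.exp_add]; ring_nf
    simp only [smul_eq_mul, binetKernel, h1]
    field_simp
    ring
  have hF : IntegrableOn
      (fun t : ℝ => t⁻¹ • (Real.exp (-(u * t)) - Real.exp (-((u + 1) * t)))) (Ioi 0) :=
    (integrableOn_congr_fun key measurableSet_Ioi).2 (hC.sub (hA.sub hB))
  have fr := Frullani.integral_Ioi_eq (f := fun x : ℝ => Real.exp (-x)) (L := 1) (R := 0)
    ((by fun_prop : Continuous fun x : ℝ => Real.exp (-x)).locallyIntegrable.locallyIntegrableOn _)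
    hu hu1
    (((by fun_prop : Continuous fun x : ℝ => Real.exp (-x)).tendsto' 0 1 (by simp)).mono_left
      nhdsWithin_le_nhds)
    Real.tendsto_exp_neg_atTop_nhds_zero hF
  have hAB : IntegrableOn (fun t : ℝ => Real.exp (-(u * t)) * binetKernel t -
      Real.exp (-((u + 1) * t)) * binetKernel t) (Ioi 0) := hA.sub hB
  rw [setIntegral_congr_fun measurableSet_Ioi key, integral_sub hC hAB, integral_sub hA hB, integral_exp_neg_mul hu1] at fr
  simp only [sub_zero, smul_eq_mul, mul_one] at fr
  rw [← fr, binetLaplace, binetLaplace]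
  ring

/-- A Binet formula: `log u - ψ(1 + u) = ∫₀^∞ (1 / (e ^ t - 1) - 1 / t) e ^ (- u t) dt`. -/
theorem log_sub_realDigamma_eq {u : ℝ} (hu : 0 < u) :
    Real.log u - realDigamma (u + 1) = binetLaplace u := by
  -- The error E has period 1 and is O(1/x) at infinity, hence vanishes.
  set E : ℝ → ℝ := fun x => Real.log x - realDigamma (x + 1) - binetLaplace x with hE
  have hper : ∀ x, 0 < x → E (x + 1) = E x := by
    intro x hx
    have h1 := binetLaplace_sub hx
    have h2 := realDigamma_add_one (by linarith : 0 < x + 1)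
    rw [Real.log_div (by linarith) hx.ne'] at h1
    simp only [hE]
    linarith
  have hn : ∀ n : ℕ, E (u + n) = E u := by
    intro n
    induction n with
    | zero => simp
    | succ n ih => rw [Nat.cast_add_one, ← add_assoc, hper _ (by positivity), ih]
  have hb : ∀ n : ℕ, |E u| ≤ 2 * (1 / ((n : ℝ) + u)) := by
    intro n
    have hp : 0 < u + n := by positivity
    rw [← hn n, add_comm (n : ℝ) u, two_mul]
    exact (abs_sub _ _).trans
      (add_le_add (abs_log_sub_realDigamma_le hp) (abs_binetLaplace_le hp))
  have hlim : Tendsto (fun n : ℕ => 2 * (1 / ((n : ℝ) + u))) atTop (𝓝 0) := by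
    simpa only [one_div, mul_zero, Function.comp_def] using
      ((tendsto_inv_atTop_zero.comp (tendsto_atTop_add_const_right _ u
        (tendsto_natCast_atTop_atTop (R := ℝ)))).const_mul 2)
  have h0 : |E u| ≤ 0 := ge_of_tendsto' hlim hb
  have := abs_nonpos_iff.1 h0
  simp only [hE] at this
  linarith

/-- The function `1 / (e ^ t - 1) - 1 / t + e ^ (-t) / 2`. -/
noncomputable def mellinKernel (t : ℝ) : ℝ := binetKernel t + Real.exp (-t) / 2

theorem integrand_zero_eq {u : ℝ} (hu : 0 < u) :
    integrand 0 u = ∫ t in Ioi (0 : ℝ), ((Real.exp (-(u * t)) * mellinKernel t : ℝ) : ℂ) := by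
  have hu1 : 0 < u + 1 := by linarith
  have h : ∫ t in Ioi (0 : ℝ), Real.exp (-(u * t)) * mellinKernel t =
      Real.log u - realDigamma (u + 1) + 1 / (2 * (1 + u)) := by
    have h1 : ∀ t : ℝ, Real.exp (-(u * t)) * mellinKernel t =
        Real.exp (-(u * t)) * binetKernel t + Real.exp (-((u + 1) * t)) / 2 := by
      intro t
      have : Real.exp (-((u + 1) * t)) = Real.exp (-(u * t)) * Real.exp (-t) := by
        rw [← Real.exp_add]; ring_nf
      rw [mellinKernel, this]
      ring
    simp only [h1]
    rw [integral_add (integrableOn_exp_mul_binetKernel hu)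
      ((integrableOn_exp_neg_mul hu1).div_const 2), integral_div, integral_exp_neg_mul hu1,
      log_sub_realDigamma_eq hu, binetLaplace, add_comm u 1]
    field_simp
  rw [integral_complex_ofReal, h, integrand, pow_zero, mul_one]
  have := digamma_ofReal hu1
  push_cast at this ⊢
  rw [add_comm (1 : ℂ), this, add_comm (u : ℂ)]

end ConnonZeta

/-! ### Kernel bounds and the Mellin transform of the Laplace transform. -/

namespace ConnonZeta

open Filter Topology MeasureTheory Set Asymptotics

/-- The term e^(-t)/2 cancels the constant -1/2 in the expansion of `binetKernel` at 0; this is what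
widens the strip to the left as far as Re s > -1. -/
lemma abs_mellinKernel_le_of_le_one {t : ℝ} (ht : 0 < t) (ht1 : t ≤ 1) :
    |mellinKernel t| ≤ t := by
  have hE := exp_sub_one_pos ht
  have h1 := Real.quadratic_le_exp_of_nonneg ht.le
  have h2 := Real.exp_bound' ht.le ht1 (n := 3) (by norm_num)
  norm_num [Finset.sum_range_succ, Nat.factorial] at h2
  have h3 : 1 - t ≤ Real.exp (-t) := by linarith [Real.add_one_le_exp (-t)]
  have h4 : Real.exp (-t) ≤ 1 := Real.exp_le_one_iff.2 (by linarith)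
  have h5 : |1 / (Real.exp t - 1) - 1 / t + 1 / 2| ≤ t / 2 := by
    have e : 1 / (Real.exp t - 1) - 1 / t + 1 / 2 =
        (2 * t - 2 * (Real.exp t - 1) + t * (Real.exp t - 1)) / (2 * t * (Real.exp t - 1)) := by
      field_simp
    have ht3 : 0 < t ^ 3 := by positivity
    rw [e, abs_div, abs_of_pos (by positivity : 0 < 2 * t * (Real.exp t - 1)),
      div_le_iff₀ (by positivity)]
    -- The numerator is O(t³): its lower-order terms cancel, and quadratic and cubic bounds for e^t
    -- give the constant 1.
    have h6 : t ^ 3 ≤ t / 2 * (2 * t * (Real.exp t - 1)) := by nlinarith [sq_nonneg t]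
    refine le_trans (abs_le.2 ⟨?_, ?_⟩) h6 <;> nlinarith
  have e : mellinKernel t =
      (1 / (Real.exp t - 1) - 1 / t + 1 / 2) + (Real.exp (-t) - 1) / 2 := by
    rw [mellinKernel, binetKernel]
    ring
  rw [e]
  refine (abs_add_le _ _).trans ?_
  have h7 : |(Real.exp (-t) - 1) / 2| ≤ t / 2 := abs_le.2 ⟨by linarith, by linarith⟩
  linarith

lemma abs_mellinKernel_le_inv {t : ℝ} (ht : 0 < t) : |mellinKernel t| ≤ t⁻¹ := by
  have hE := exp_sub_one_pos ht
  have h1 : Real.exp (-t) / 2 ≤ t⁻¹ := by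
    rw [← one_div, le_div_iff₀ ht]
    have h2 : Real.exp (-t) * Real.exp t = 1 := by rw [← Real.exp_add]; simp
    nlinarith [Real.exp_pos (-t), Real.add_one_le_exp t]
  have h2 : 1 / (Real.exp t - 1) ≤ 1 / t :=
    one_div_le_one_div_of_le ht (by linarith [Real.add_one_le_exp t])
  have h3 : 0 < 1 / (Real.exp t - 1) := by positivity
  rw [mellinKernel, binetKernel, abs_le]
  rw [one_div t] at *
  constructor <;> linarith [Real.exp_pos (-t)]

lemma abs_mellinKernel_le_rpow {a t : ℝ} (h1 : -1 ≤ a) (h2 : a ≤ 1) (ht : 0 < t) :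
    |mellinKernel t| ≤ t ^ a := by
  rcases le_total t 1 with h | h
  · calc _ ≤ t := abs_mellinKernel_le_of_le_one ht h
      _ = t ^ (1 : ℝ) := (Real.rpow_one t).symm
      _ ≤ _ := Real.rpow_le_rpow_of_exponent_ge ht h h2
  · calc _ ≤ t⁻¹ := abs_mellinKernel_le_inv ht
      _ = t ^ (-1 : ℝ) := (Real.rpow_neg_one t).symm
      _ ≤ _ := Real.rpow_le_rpow_of_exponent_le h h1

lemma continuousOn_mellinKernel : ContinuousOn mellinKernel (Ioi 0) :=
  continuousOn_binetKernel.add (by fun_prop)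

lemma locallyIntegrableOn_mellinKernel :
    LocallyIntegrableOn (fun t => (mellinKernel t : ℂ)) (Ioi 0) :=
  (Complex.continuous_ofReal.comp_continuousOn continuousOn_mellinKernel).locallyIntegrableOn
    measurableSet_Ioi

lemma mellinKernel_isBigO_top :
    (fun t => (mellinKernel t : ℂ)) =O[atTop] fun t : ℝ => t ^ (-1 : ℝ) := by
  refine IsBigO.of_bound 1 ?_
  filter_upwards [eventually_gt_atTop 0] with t ht
  rw [one_mul, Complex.norm_real, Real.norm_of_nonneg (Real.rpow_nonneg ht.le _)]
  exact abs_mellinKernel_le_rpow le_rfl (by norm_num) ht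

lemma mellinKernel_isBigO_zero :
    (fun t => (mellinKernel t : ℂ)) =O[𝓝[>] 0] fun t : ℝ => t ^ (-(-1) : ℝ) := by
  refine IsBigO.of_bound 1 ?_
  filter_upwards [self_mem_nhdsWithin] with t ht
  rw [one_mul, Complex.norm_real, Real.norm_of_nonneg (Real.rpow_nonneg (mem_Ioi.1 ht).le _)]
  exact abs_mellinKernel_le_rpow (by norm_num) (by norm_num) ht

lemma mellinConvergent_mellinKernel {s : ℂ} (h1 : -1 < s.re) (h2 : s.re < 1) :
    MellinConvergent (fun t => (mellinKernel t : ℂ)) s :=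
  mellinConvergent_of_isBigO_rpow locallyIntegrableOn_mellinKernel mellinKernel_isBigO_top h2
    mellinKernel_isBigO_zero h1

lemma differentiableAt_mellin_mellinKernel {s : ℂ} (h1 : -1 < s.re) (h2 : s.re < 1) :
    DifferentiableAt ℂ (mellin fun t => (mellinKernel t : ℂ)) s :=
  mellin_differentiableAt_of_isBigO_rpow locallyIntegrableOn_mellinKernel mellinKernel_isBigO_top
    h2 mellinKernel_isBigO_zero h1

lemma integrableOn_rpow_mul_exp_neg_mul {a r : ℝ} (ha : 0 < a) (hr : 0 < r) :
    IntegrableOn (fun t : ℝ => t ^ (a - 1) * Real.exp (-(r * t))) (Ioi 0) := by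
  refine .of_integral_ne_zero ?_
  rw [Real.integral_rpow_mul_exp_neg_mul_Ioi ha hr]
  have := Real.Gamma_pos_of_pos ha
  positivity

/-- Bounding the kernel by t^(a-1) turns the Laplace integral into a Gamma integral. Small `a`
serves u → 0, and `a` near 2 serves u → ∞. -/
lemma norm_integrand_zero_le {a u : ℝ} (h1 : 0 < a) (h2 : a ≤ 2) (hu : 0 < u) :
    ‖integrand 0 u‖ ≤ Real.Gamma a * u ^ (-a) := by
  have e : Real.Gamma a * u ^ (-a) =
      ∫ t in Ioi (0 : ℝ), t ^ (a - 1) * Real.exp (-(u * t)) := by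
    rw [Real.integral_rpow_mul_exp_neg_mul_Ioi h1 hu, one_div, Real.inv_rpow hu.le,
      Real.rpow_neg hu.le, mul_comm]
  rw [integrand_zero_eq hu, e]
  refine norm_integral_le_of_norm_le (integrableOn_rpow_mul_exp_neg_mul h1 hu) ?_
  filter_upwards [ae_restrict_mem measurableSet_Ioi] with t ht
  rw [Complex.norm_real, norm_mul, Real.norm_of_nonneg (Real.exp_pos _).le, mul_comm]
  exact mul_le_mul_of_nonneg_right
    (abs_mellinKernel_le_rpow (by linarith) (by linarith) ht) (Real.exp_pos _).le

/-- Tonelli: integrating the norm over u leaves Γ(1 - Re s) t^(Re s - 1) |K(t)|, which is integrable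
on the strip. -/
lemma integrable_mellin_laplace {s : ℂ} (h1 : -1 < s.re) (h2 : s.re < 1) :
    Integrable (Function.uncurry fun u t : ℝ =>
        (u : ℂ) ^ ((1 - s) - 1) * ((Real.exp (-(u * t)) * mellinKernel t : ℝ) : ℂ))
      ((volume.restrict (Ioi 0)).prod (volume.restrict (Ioi 0))) := by
  have hs : 0 < (1 - s).re := by simp; linarith
  have hs' : 0 < 1 - s.re := by linarith
  have hnorm : ∀ t ∈ Ioi (0 : ℝ), ∀ u ∈ Ioi (0 : ℝ),
      ‖(u : ℂ) ^ ((1 - s) - 1) * ((Real.exp (-(u * t)) * mellinKernel t : ℝ) : ℂ)‖ =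
        u ^ ((1 - s.re) - 1) * Real.exp (-(t * u)) * |mellinKernel t| := by
    intro t _ u hu
    rw [norm_mul, Complex.norm_cpow_eq_rpow_re_of_pos hu, Complex.norm_real, norm_mul,
      Real.norm_of_nonneg (Real.exp_pos _).le, Real.norm_eq_abs, mul_assoc, mul_comm u t]
    simp
  have hmeas : AEStronglyMeasurable (Function.uncurry fun u t : ℝ =>
        (u : ℂ) ^ ((1 - s) - 1) * ((Real.exp (-(u * t)) * mellinKernel t : ℝ) : ℂ))
      ((volume.restrict (Ioi 0)).prod (volume.restrict (Ioi 0))) := by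
    rw [Measure.prod_restrict]
    refine ContinuousOn.aestronglyMeasurable (ContinuousOn.mul ?_ ?_)
      (measurableSet_Ioi.prod measurableSet_Ioi)
    · refine ContinuousOn.comp (g := fun u : ℝ => (u : ℂ) ^ ((1 - s) - 1)) (t := Ioi 0)
        (fun u hu => ?_) continuousOn_fst fun p hp => hp.1
      exact (Complex.continuousAt_ofReal_cpow_const _ _
        (Or.inr (mem_Ioi.1 hu).ne')).continuousWithinAt
    · refine Complex.continuous_ofReal.comp_continuousOn (ContinuousOn.mul (by fun_prop) ?_)
      exact continuousOn_mellinKernel.comp continuousOn_snd fun p hp => hp.2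
  rw [integrable_prod_iff' hmeas]
  constructor
  · filter_upwards [ae_restrict_mem measurableSet_Ioi] with t ht
    have hm : AEStronglyMeasurable (fun u : ℝ =>
        (u : ℂ) ^ ((1 - s) - 1) * ((Real.exp (-(u * t)) * mellinKernel t : ℝ) : ℂ))
        (volume.restrict (Ioi 0)) := by
      refine ContinuousOn.aestronglyMeasurable (ContinuousOn.mul (fun u hu => ?_) (by fun_prop))
        measurableSet_Ioi
      exact (Complex.continuousAt_ofReal_cpow_const _ _
        (Or.inr (mem_Ioi.1 hu).ne')).continuousWithinAt
    refine (integrable_norm_iff hm).1 ?_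
    exact (integrableOn_congr_fun (hnorm t ht) measurableSet_Ioi).2
      ((integrableOn_rpow_mul_exp_neg_mul hs' ht).mul_const _)
  · have hI := ((mellinConvergent_mellinKernel h1 h2).norm).const_mul (Real.Gamma (1 - s.re))
    refine hI.congr ?_
    filter_upwards [ae_restrict_mem measurableSet_Ioi] with t ht
    refine Eq.trans ?_ (setIntegral_congr_fun measurableSet_Ioi (hnorm t ht)).symm
    rw [integral_mul_const, Real.integral_rpow_mul_exp_neg_mul_Ioi hs' ht, norm_smul,
      Complex.norm_cpow_eq_rpow_re_of_pos ht, Complex.norm_real, Real.norm_eq_abs, one_div,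
      Real.inv_rpow (mem_Ioi.1 ht).le, ← Real.rpow_neg (mem_Ioi.1 ht).le, neg_sub,
      Complex.sub_re, Complex.one_re]
    ring

theorem mellin_integrand_zero {s : ℂ} (h1 : -1 < s.re) (h2 : s.re < 1) :
    mellin (integrand 0) (1 - s) =
      Complex.Gamma (1 - s) * mellin (fun t => (mellinKernel t : ℂ)) s := by
  have hs : 0 < (1 - s).re := by simp; linarith
  calc mellin (integrand 0) (1 - s) = ∫ u in Ioi (0 : ℝ), ∫ t in Ioi (0 : ℝ),
        (u : ℂ) ^ ((1 - s) - 1) * ((Real.exp (-(u * t)) * mellinKernel t : ℝ) : ℂ) := by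
        refine setIntegral_congr_fun measurableSet_Ioi fun u hu => ?_
        simp only [integrand_zero_eq hu, smul_eq_mul, integral_const_mul]
    _ = ∫ t in Ioi (0 : ℝ), ∫ u in Ioi (0 : ℝ),
        (u : ℂ) ^ ((1 - s) - 1) * ((Real.exp (-(u * t)) * mellinKernel t : ℝ) : ℂ) :=
        integral_integral_swap (integrable_mellin_laplace h1 h2)
    _ = ∫ t in Ioi (0 : ℝ), Complex.Gamma (1 - s) *
        ((t : ℂ) ^ (s - 1) • (mellinKernel t : ℂ)) := by
        refine setIntegral_congr_fun measurableSet_Ioi fun t ht => ?_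
        have h := Complex.integral_cpow_mul_exp_neg_mul_Ioi hs ht
        have e : ∀ u : ℝ, (u : ℂ) ^ ((1 - s) - 1) *
            ((Real.exp (-(u * t)) * mellinKernel t : ℝ) : ℂ) =
            (u : ℂ) ^ ((1 - s) - 1) * Complex.exp (-(t * u)) * (mellinKernel t : ℂ) := by
          intro u
          push_cast
          rw [mul_comm (u : ℂ) t, mul_assoc]
        simp only [e]
        rw [integral_mul_const, h, one_div,
          Complex.inv_cpow_ofReal_nonneg (mem_Ioi.1 ht).le, ← Complex.cpow_neg, neg_sub,
          smul_eq_mul]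
        ring
    _ = _ := integral_const_mul _ _

end ConnonZeta

/-! ### The zeta function as a Mellin transform, continued to |Re s| < 1. -/

namespace ConnonZeta

open Filter Topology MeasureTheory Set Asymptotics

lemma hasSum_exp_neg_mul {t : ℝ} (ht : 0 < t) :
    HasSum (fun n : ℕ => (1 : ℂ) * (Real.exp (-((n : ℝ) + 1) * t) : ℂ))
      ((1 / (Real.exp t - 1) : ℝ) : ℂ) := by
  have h1 : Real.exp (-t) < 1 := Real.exp_lt_one_iff.2 (by linarith)
  have h := (hasSum_geometric_of_lt_one (Real.exp_pos (-t)).le h1).mul_left (Real.exp (-t))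
  have e : 1 / (Real.exp t - 1) = Real.exp (-t) * (1 - Real.exp (-t))⁻¹ := by
    have hE := (exp_sub_one_pos ht).ne'
    have h2 : 1 - Real.exp (-t) ≠ 0 := by linarith
    rw [Real.exp_neg] at *
    have h3 := Real.exp_ne_zero t
    field_simp
  rw [e]
  have e2 : ∀ n : ℕ, (1 : ℂ) * (Real.exp (-((n : ℝ) + 1) * t) : ℂ) =
      ((Real.exp (-t) * Real.exp (-t) ^ n : ℝ) : ℂ) := by
    intro n
    rw [one_mul, ← Real.exp_nat_mul, ← Real.exp_add]
    ring_nf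
  simp only [e2]
  exact Complex.hasSum_ofReal.2 h

lemma mellin_one_div_exp_sub_one {s : ℂ} (hs : 1 < s.re) :
    mellin (fun t : ℝ => ((1 / (Real.exp t - 1) : ℝ) : ℂ)) s =
      Complex.Gamma s * riemannZeta s := by
  have h := hasSum_mellin (a := fun _ : ℕ => (1 : ℂ)) (p := fun n : ℕ => (n : ℝ) + 1)
    (F := fun t : ℝ => ((1 / (Real.exp t - 1) : ℝ) : ℂ)) (s := s)
    (fun n => Or.inr (by positivity)) (by linarith) (fun t ht => hasSum_exp_neg_mul ht) ?_
  · rw [← h.tsum_eq, zeta_eq_tsum_one_div_nat_add_one_cpow hs, ← tsum_mul_left]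
    refine tsum_congr fun n => ?_
    push_cast
    ring
  · have := (summable_nat_add_iff 1).2 (Real.summable_one_div_nat_rpow.2 hs)
    simpa using this

/-- The function `1 / (e ^ t - 1)` with its singularity at `0` removed on `(0, 1]`. -/
noncomputable def truncatedKernel (t : ℝ) : ℝ :=
  binetKernel t + indicator (Ioi 1) (fun x => (max x 1)⁻¹) t

lemma locallyIntegrableOn_truncatedKernel :
    LocallyIntegrableOn (fun t => (truncatedKernel t : ℂ)) (Ioi 0) := by
  have h1 : LocallyIntegrableOn (fun t => (binetKernel t : ℂ)) (Ioi 0) :=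
    (Complex.continuous_ofReal.comp_continuousOn continuousOn_binetKernel).locallyIntegrableOn
      measurableSet_Ioi
  -- The `max x 1` makes the function under the indicator continuous on all of ℝ; on (1, ∞) it is
  -- 1/x.
  have hc : Continuous fun x : ℝ => (((max x 1)⁻¹ : ℝ) : ℂ) := by
    refine Complex.continuous_ofReal.comp (Continuous.inv₀ (by fun_prop) fun x => ?_)
    positivity
  have h2 := (hc.locallyIntegrable (μ := volume)).indicator (measurableSet_Ioi (a := (1 : ℝ)))
  convert! h1.add (h2.locallyIntegrableOn _) using 1
  ext t
  by_cases ht : t ∈ Ioi (1 : ℝ) <;> simp [truncatedKernel, ht]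

lemma truncatedKernel_isBigO_top :
    (fun t => (truncatedKernel t : ℂ)) =O[atTop] fun t : ℝ => Real.exp (-1 * t) := by
  refine IsBigO.of_bound 2 ?_
  filter_upwards [eventually_gt_atTop 1] with t ht
  have h1 := Real.add_one_le_exp t
  have h2 : Real.exp (-1 * t) * Real.exp t = 1 := by rw [← Real.exp_add]; simp
  have hE := exp_sub_one_pos (zero_lt_one.trans ht)
  have e : truncatedKernel t = 1 / (Real.exp t - 1) := by
    rw [truncatedKernel, binetKernel, indicator_of_mem (mem_Ioi.2 ht), max_eq_left ht.le]
    ring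
  rw [e, Complex.norm_real, Real.norm_of_nonneg (by positivity),
    Real.norm_of_nonneg (Real.exp_pos _).le, div_le_iff₀ hE]
  nlinarith [Real.exp_pos (-1 * t)]

lemma truncatedKernel_isBigO_zero :
    (fun t => (truncatedKernel t : ℂ)) =O[𝓝[>] 0] fun t : ℝ => t ^ (-0 : ℝ) := by
  refine IsBigO.of_bound 1 ?_
  filter_upwards [Ioc_mem_nhdsGT (zero_lt_one (α := ℝ))] with t ht
  have e : truncatedKernel t = binetKernel t := by
    rw [truncatedKernel, indicator_of_notMem (by simpa using ht.2), add_zero]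
  rw [e, Complex.norm_real, neg_zero, Real.rpow_zero, norm_one, mul_one]
  exact abs_binetKernel_le_one ht.1

lemma mellinConvergent_truncatedKernel {s : ℂ} (hs : 0 < s.re) :
    MellinConvergent (fun t => (truncatedKernel t : ℂ)) s :=
  mellinConvergent_of_isBigO_rpow_exp one_pos locallyIntegrableOn_truncatedKernel
    truncatedKernel_isBigO_top truncatedKernel_isBigO_zero hs

lemma differentiableAt_mellin_truncatedKernel {s : ℂ} (hs : 0 < s.re) :
    DifferentiableAt ℂ (mellin fun t => (truncatedKernel t : ℂ)) s :=
  mellin_differentiableAt_of_isBigO_rpow_exp one_pos locallyIntegrableOn_truncatedKernel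
    truncatedKernel_isBigO_top truncatedKernel_isBigO_zero hs

lemma mellin_truncatedKernel_of_one_lt_re {s : ℂ} (hs : 1 < s.re) :
    mellin (fun t => (truncatedKernel t : ℂ)) s =
      Complex.Gamma s * riemannZeta s - 1 / (s - 1) := by
  have h1 := mellinConvergent_truncatedKernel (s := s) (by linarith)
  have h2 := hasMellin_cpow_Ioc (-1) (s := s) (by simpa using hs)
  have h3 := (hasMellin_add h1 h2.1).2
  rw [h2.2, ← sub_eq_add_neg] at h3
  rw [eq_sub_iff_add_eq, ← h3, ← mellin_one_div_exp_sub_one hs]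
  refine setIntegral_congr_fun measurableSet_Ioi fun t ht => ?_
  simp only
  congr 1
  rcases le_or_gt t 1 with h | h
  · rw [truncatedKernel, indicator_of_notMem (by simpa using h), indicator_of_mem (mem_Ioc.2 ⟨ht, h⟩),
      Complex.cpow_neg_one, binetKernel]
    push_cast
    ring
  · rw [truncatedKernel, indicator_of_mem (mem_Ioi.2 h), max_eq_left h.le,
      indicator_of_notMem (fun h' => absurd h'.2 (not_le.2 h)), binetKernel]
    push_cast
    ring

/-- Identity theorem on a convex quadrant avoiding the pole s = 1. The upper half suffices, as the
result only seeds a further continuation. -/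
lemma mellin_truncatedKernel_of_im_pos {s : ℂ} (hs : 0 < s.re) (hi : 0 < s.im) :
    mellin (fun t => (truncatedKernel t : ℂ)) s =
      Complex.Gamma s * riemannZeta s - 1 / (s - 1) := by
  set U : Set ℂ := {z | 0 < z.re} ∩ {z | 0 < z.im} with hU
  have hUo : IsOpen U :=
    (isOpen_lt continuous_const Complex.continuous_re).inter
      (isOpen_lt continuous_const Complex.continuous_im)
  have hUc : IsPreconnected U :=
    ((convex_halfSpace_re_gt 0).inter (convex_halfSpace_im_gt 0)).isPreconnected
  have hne : ∀ z ∈ U, z ≠ 1 := by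
    rintro z hz rfl
    simpa using hz.2
  have h1 : AnalyticOnNhd ℂ (mellin fun t => (truncatedKernel t : ℂ)) U :=
    DifferentiableOn.analyticOnNhd
      (fun z hz => (differentiableAt_mellin_truncatedKernel hz.1).differentiableWithinAt) hUo
  have h2 : AnalyticOnNhd ℂ (fun z => Complex.Gamma z * riemannZeta z - 1 / (z - 1)) U := by
    refine DifferentiableOn.analyticOnNhd (fun z hz => ?_) hUo
    refine DifferentiableAt.differentiableWithinAt ?_
    refine ((analyticAt_Gamma_of_re_pos hz.1).differentiableAt.mul
      (differentiableAt_riemannZeta (hne z hz))).sub ?_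
    exact (differentiableAt_const _).div (by fun_prop) (sub_ne_zero.2 (hne z hz))
  refine h1.eqOn_of_preconnected_of_eventuallyEq h2 hUc (z₀ := 2 + Complex.I)
    (by simp [hU]) ?_ ⟨hs, hi⟩
  filter_upwards [(isOpen_lt continuous_const Complex.continuous_re).mem_nhds
    (by simp : (1 : ℝ) < (2 + Complex.I).re)] with z hz
  exact mellin_truncatedKernel_of_one_lt_re hz

/-- Once Re s < 1, the removed tail 1/t on (1, ∞) has Mellin transform -1/(s - 1), which cancels the
polar term. -/
lemma mellin_mellinKernel_of_im_pos {s : ℂ} (hs : 0 < s.re) (hs1 : s.re < 1) (hi : 0 < s.im) :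
    mellin (fun t => (mellinKernel t : ℂ)) s =
      Complex.Gamma s * (riemannZeta s + 1 / 2) := by
  have h1 := mellinConvergent_truncatedKernel hs
  have h2 : HasMellin (indicator (Ioi 1) fun t : ℝ => (t : ℂ) ^ (-1 : ℂ)) s (-1 / (s - 1)) := by
    have ha : (s - 1 + -1).re < -1 := by simp; linarith
    have e : ∀ t : ℝ, (t : ℂ) ^ (s - 1) • (indicator (Ioi 1) (fun t : ℝ => (t : ℂ) ^ (-1 : ℂ)) t) =
        indicator (Ioi 1) (fun t : ℝ => (t : ℂ) ^ (s - 1 + -1)) t := by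
      intro t
      by_cases ht : t ∈ Ioi (1 : ℝ)
      · have : (t : ℂ) ≠ 0 := by
          exact_mod_cast (zero_lt_one.trans (mem_Ioi.1 ht)).ne'
        rw [indicator_of_mem ht, indicator_of_mem ht, Complex.cpow_add _ _ this, smul_eq_mul]
      · rw [indicator_of_notMem ht, indicator_of_notMem ht, smul_zero]
    have hsub : Ioi (1 : ℝ) ⊆ Ioi 0 := Ioi_subset_Ioi zero_le_one
    constructor
    · simp only [MellinConvergent, e]
      exact ((integrable_indicator_iff measurableSet_Ioi).2
        (integrableOn_Ioi_cpow_of_lt ha one_pos)).integrableOn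
    · simp only [mellin, e]
      rw [setIntegral_indicator measurableSet_Ioi, inter_eq_self_of_subset_right hsub,
        integral_Ioi_cpow_of_lt ha one_pos]
      simp
  have h3 : HasMellin (fun t : ℝ => (Real.exp (-t) : ℂ)) s (Complex.Gamma s) := by
    constructor
    · refine (Complex.GammaIntegral_convergent hs).congr_fun (fun t _ => ?_) measurableSet_Ioi
      simp [mul_comm]
    · rw [Complex.Gamma_eq_integral hs, Complex.GammaIntegral_eq_mellin]
  have h4 := hasMellin_sub h1 h2.1
  have h5 := hasMellin_add h4.1 (h3.1.const_smul (1 / 2 : ℂ))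
  have e := h5.2
  rw [h4.2, h2.2, mellin_const_smul, h3.2, mellin_truncatedKernel_of_im_pos hs hi] at e
  have hs' : s - 1 ≠ 0 := by
    intro h
    rw [sub_eq_zero.1 h] at hs1
    simp at hs1
  trans Complex.Gamma s * riemannZeta s - 1 / (s - 1) - -1 / (s - 1) +
    (1 / 2 : ℂ) • Complex.Gamma s
  · rw [← e]
    refine setIntegral_congr_fun measurableSet_Ioi fun t ht => ?_
    simp only
    congr 1
    by_cases h : t ∈ Ioi (1 : ℝ)
    · rw [truncatedKernel, mellinKernel, indicator_of_mem h, indicator_of_mem h,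
        max_eq_left (mem_Ioi.1 h).le, Complex.cpow_neg_one, smul_eq_mul]
      push_cast
      ring
    · rw [truncatedKernel, mellinKernel, indicator_of_notMem h, indicator_of_notMem h, smul_eq_mul]
      push_cast
      ring
  · rw [smul_eq_mul]
    ring

/-- The factor s turns Γ(s) into Γ(1 + s), so both sides are holomorphic across s = 0 and the
identity theorem covers the whole strip. -/
theorem mul_mellin_mellinKernel {s : ℂ} (h1 : -1 < s.re) (h2 : s.re < 1) :
    s * mellin (fun t => (mellinKernel t : ℂ)) s =
      Complex.Gamma (1 + s) * (riemannZeta s + 1 / 2) := by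
  set V : Set ℂ := {z | -1 < z.re} ∩ {z | z.re < 1} with hV
  have hVo : IsOpen V :=
    (isOpen_lt continuous_const Complex.continuous_re).inter
      (isOpen_lt Complex.continuous_re continuous_const)
  have hVc : IsPreconnected V :=
    ((convex_halfSpace_re_gt (-1)).inter (convex_halfSpace_re_lt 1)).isPreconnected
  have hne : ∀ z ∈ V, z ≠ 1 := by
    rintro z hz rfl
    simpa using hz.2
  have hA : AnalyticOnNhd ℂ (fun z => z * mellin (fun t => (mellinKernel t : ℂ)) z) V :=
    DifferentiableOn.analyticOnNhd (fun z hz => (differentiableAt_id.mul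
      (differentiableAt_mellin_mellinKernel hz.1 hz.2)).differentiableWithinAt) hVo
  have hB : AnalyticOnNhd ℂ (fun z => Complex.Gamma (1 + z) * (riemannZeta z + 1 / 2)) V := by
    refine DifferentiableOn.analyticOnNhd (fun z hz => ?_) hVo
    refine DifferentiableAt.differentiableWithinAt ?_
    have hz' : 0 < (1 + z).re := by
      have : -1 < z.re := hz.1
      simp
      linarith
    exact ((analyticAt_Gamma_of_re_pos hz').differentiableAt.fun_comp' z (by fun_prop)).mul
      ((differentiableAt_riemannZeta (hne z hz)).add_const _)
  refine hA.eqOn_of_preconnected_of_eventuallyEq hB hVc (z₀ := 1 / 2 + Complex.I)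
    (by simp [hV]; norm_num) ?_ ⟨h1, h2⟩
  have hW : IsOpen ({z : ℂ | 0 < z.re} ∩ {z | z.re < 1} ∩ {z | 0 < z.im}) :=
    ((isOpen_lt continuous_const Complex.continuous_re).inter
      (isOpen_lt Complex.continuous_re continuous_const)).inter
      (isOpen_lt continuous_const Complex.continuous_im)
  filter_upwards [hW.mem_nhds (by simp; norm_num :
    (1 / 2 + Complex.I) ∈ {z : ℂ | 0 < z.re} ∩ {z | z.re < 1} ∩ {z | 0 < z.im})] with z hz
  have hz0 : z ≠ 0 := by
    rintro rfl
    simpa using hz.2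
  rw [mellin_mellinKernel_of_im_pos hz.1.1 hz.1.2 hz.2, add_comm 1 z, Complex.Gamma_add_one z hz0,
    mul_assoc]

/-- The Mellin transform of the integrand in terms of the zeta function. -/
theorem mul_mellin_integrand_zero {s : ℂ} (h1 : -1 < s.re) (h2 : s.re < 1) :
    s * mellin (integrand 0) (1 - s) = gammaProd s * (riemannZeta s + 1 / 2) := by
  rw [mellin_integrand_zero h1 h2, mul_left_comm, mul_mellin_mellinKernel h1 h2, gammaProd,
    mul_assoc]

end ConnonZeta

/-! ### Convergence of the integrals and derivatives at 0. -/

namespace ConnonZeta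

open Filter Topology MeasureTheory Set Asymptotics

lemma integrand_succ (m : ℕ) (u : ℝ) : integrand (m + 1) u = Real.log u • integrand m u := by
  rw [integrand, integrand, Complex.real_smul, pow_succ]
  ring

lemma continuousOn_integrand (m : ℕ) : ContinuousOn (integrand m) (Ioi 0) := by
  have hl : ContinuousOn (fun u : ℝ => (Real.log u : ℂ)) (Ioi 0) :=
    Complex.continuous_ofReal.comp_continuousOn
      (Real.continuousOn_log.mono fun u hu => (mem_Ioi.1 hu).ne')
  have hd : ContinuousOn (fun u : ℝ => Complex.digamma (1 + (u : ℂ))) (Ioi 0) := by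
    intro u hu
    have hre : 0 < (1 + (u : ℂ)).re := by
      have := mem_Ioi.1 hu
      simp
      linarith
    exact (ContinuousAt.comp (f := fun u : ℝ => 1 + (u : ℂ))
      (analyticAt_digamma_of_re_pos hre).continuousAt (by fun_prop)).continuousWithinAt
  have hq : ContinuousOn (fun u : ℝ => 1 / (2 * (1 + (u : ℂ)))) (Ioi 0) := by
    refine continuousOn_const.div (by fun_prop) fun u hu => ?_
    have : (2 * (1 + u) : ℝ) ≠ 0 := by
      have := mem_Ioi.1 hu
      positivity
    exact_mod_cast this
  exact ((hl.sub hd).add hq).mul (hl.pow m)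

lemma locallyIntegrableOn_integrand (m : ℕ) : LocallyIntegrableOn (integrand m) (Ioi 0) :=
  (continuousOn_integrand m).locallyIntegrableOn measurableSet_Ioi

/-- Each logarithm costs an arbitrarily small part of the exponent, so the induction runs over all
`a` in the open interval. -/
lemma integrand_isBigO_top (m : ℕ) {a : ℝ} (h0 : 0 < a) (h2 : a < 2) :
    integrand m =O[atTop] fun u : ℝ => u ^ (-a) := by
  induction m generalizing a with
  | zero =>
    refine IsBigO.of_bound (Real.Gamma a) ?_
    filter_upwards [eventually_gt_atTop 0] with u hu
    rw [Real.norm_of_nonneg (Real.rpow_nonneg hu.le _)]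
    exact norm_integrand_zero_le h0 h2.le hu
  | succ m ih =>
    obtain ⟨b, hab, hb2⟩ := exists_between h2
    simpa only [← integrand_succ] using isBigO_rpow_top_log_smul hab (ih (h0.trans hab) hb2)

lemma integrand_isBigO_zero (m : ℕ) {a : ℝ} (h0 : 0 < a) (h2 : a < 2) :
    integrand m =O[𝓝[>] 0] fun u : ℝ => u ^ (-a) := by
  induction m generalizing a with
  | zero =>
    refine IsBigO.of_bound (Real.Gamma a) ?_
    filter_upwards [self_mem_nhdsWithin] with u hu
    rw [Real.norm_of_nonneg (Real.rpow_nonneg (mem_Ioi.1 hu).le _)]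
    exact norm_integrand_zero_le h0 h2.le hu
  | succ m ih =>
    obtain ⟨b, hb0, hba⟩ := exists_between h0
    simpa only [← integrand_succ] using isBigO_rpow_zero_log_smul hba (ih hb0 (hba.trans h2))

lemma mellinConvergent_integrand (m : ℕ) {s : ℂ} (h0 : 0 < s.re) (h2 : s.re < 2) :
    MellinConvergent (integrand m) s := by
  obtain ⟨a, ha, ha2⟩ := exists_between h2
  obtain ⟨b, hb0, hb⟩ := exists_between h0
  exact mellinConvergent_of_isBigO_rpow (locallyIntegrableOn_integrand m)
    (integrand_isBigO_top m (h0.trans ha) ha2) ha (integrand_isBigO_zero m hb0 (hb.trans h2)) hb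

lemma hasDerivAt_mellin_integrand (m : ℕ) {s : ℂ} (h0 : 0 < s.re) (h2 : s.re < 2) :
    HasDerivAt (mellin (integrand m)) (mellin (integrand (m + 1)) s) s := by
  obtain ⟨a, ha, ha2⟩ := exists_between h2
  obtain ⟨b, hb0, hb⟩ := exists_between h0
  simpa only [← integrand_succ] using
    (mellin_hasDerivAt_of_isBigO_rpow (locallyIntegrableOn_integrand m)
      (integrand_isBigO_top m (h0.trans ha) ha2) ha
      (integrand_isBigO_zero m hb0 (hb.trans h2)) hb).2

theorem integrableOn_integrand (m : ℕ) : IntegrableOn (integrand m) (Ioi 0) := by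
  simpa [MellinConvergent] using mellinConvergent_integrand m (s := 1) (by simp) (by simp)

lemma iteratedDeriv_mellin_integrand (m : ℕ) {s : ℂ} (h0 : 0 < s.re) (h2 : s.re < 2) :
    iteratedDeriv m (mellin (integrand 0)) s = mellin (integrand m) s := by
  have hU : IsOpen {z : ℂ | 0 < z.re ∧ z.re < 2} :=
    (isOpen_lt continuous_const Complex.continuous_re).inter
      (isOpen_lt Complex.continuous_re continuous_const)
  induction m generalizing s with
  | zero => rw [iteratedDeriv_zero]
  | succ m ih =>
    have he : iteratedDeriv m (mellin (integrand 0)) =ᶠ[𝓝 s] mellin (integrand m) := by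
      filter_upwards [hU.mem_nhds ⟨h0, h2⟩] with z hz using ih hz.1 hz.2
    rw [iteratedDeriv_succ, he.deriv_eq, (hasDerivAt_mellin_integrand m h0 h2).deriv]

lemma iteratedDeriv_mellin_one_sub_zero (m : ℕ) :
    iteratedDeriv m (fun s => mellin (integrand 0) (1 - s)) 0 =
      (-1) ^ m * ∫ u in Ioi (0 : ℝ), integrand m u := by
  rw [iteratedDeriv_comp_const_sub]
  simp only [sub_zero, smul_eq_mul]
  rw [iteratedDeriv_mellin_integrand m (by simp) (by simp), mellin]
  simp

lemma analyticAt_mellin_one_sub_zero :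
    AnalyticAt ℂ (fun s => mellin (integrand 0) (1 - s)) 0 := by
  rw [Complex.analyticAt_iff_eventually_differentiableAt]
  filter_upwards [eventually_re_mem_strip] with s hs
  exact (hasDerivAt_mellin_integrand 0 (by simp; linarith [hs.2])
    (by simp; linarith [hs.1])).differentiableAt.fun_comp' s (by fun_prop)

/-- Only the first derivative of s is nonzero at 0; this produces the factor n in both formulas. -/
lemma iteratedDeriv_id_mul_zero {f : ℂ → ℂ} (hf : AnalyticAt ℂ f 0) (n : ℕ) :
    iteratedDeriv (n + 1) (fun s => s * f s) 0 = (n + 1) * iteratedDeriv n f 0 := by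
  have := iteratedDeriv_fun_mul (n := n + 1) (f := fun s : ℂ => s) (g := f) (x := 0)
    contDiffAt_id hf.contDiffAt
  rw [this, Finset.sum_eq_single 1]
  · simp [iteratedDeriv_fun_id_zero]
  · intro i _ hi
    simp [iteratedDeriv_fun_id_zero, hi]
  · simp

lemma iteratedDeriv_riemannZeta_add (n : ℕ) :
    iteratedDeriv (n + 1) (fun s => riemannZeta s + 1 / 2) 0 =
      iteratedDeriv (n + 1) riemannZeta 0 := by
  rw [iteratedDeriv_succ', iteratedDeriv_succ']
  congr 1
  ext s
  exact deriv_add_const _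

lemma analyticAt_riemannZeta_zero : AnalyticAt ℂ riemannZeta 0 := by
  rw [Complex.analyticAt_iff_eventually_differentiableAt]
  filter_upwards [isOpen_ne.mem_nhds (zero_ne_one : (0 : ℂ) ≠ 1)] with s hs
  exact differentiableAt_riemannZeta hs

theorem iteratedDeriv_riemannZeta_zero (n : ℕ) :
    iteratedDeriv (n + 1) riemannZeta 0 =
      ((n : ℂ) + 1) * ∑ k ∈ Finset.range (n + 1),
        (n.choose k : ℂ) * completeBell k (psiSeq 0) *
          ((-1) ^ (n - k) * ∫ u in Ioi (0 : ℝ), integrand (n - k) u) := by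
  have hP : AnalyticAt ℂ gammaProd⁻¹ 0 :=
    (analyticAt_gammaProd (by simp) (by simp)).inv (gammaProd_ne_zero (by simp) (by simp))
  have hG := analyticAt_mellin_one_sub_zero
  have he : (fun s => riemannZeta s + 1 / 2) =ᶠ[𝓝 0]
      fun s => s * (gammaProd⁻¹ * fun s => mellin (integrand 0) (1 - s)) s := by
    filter_upwards [eventually_re_mem_strip] with s hs
    have hne := gammaProd_ne_zero hs.1 hs.2
    rw [Pi.mul_apply, Pi.inv_apply, mul_left_comm, mul_mellin_integrand_zero hs.1 hs.2,
      inv_mul_cancel_left₀ hne]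
  rw [← iteratedDeriv_riemannZeta_add, he.iteratedDeriv_eq, iteratedDeriv_id_mul_zero (hP.mul hG),
    iteratedDeriv_mul hP.contDiffAt hG.contDiffAt]
  simp only [iteratedDeriv_inv_gammaProd_zero, iteratedDeriv_mellin_one_sub_zero]

theorem sum_iteratedDeriv_riemannZeta_zero (n : ℕ) :
    ∑ k ∈ Finset.range (n + 1), ((n + 1).choose k : ℂ) *
        iteratedDeriv (n + 1 - k) riemannZeta 0 * completeBell k (fun j => -psiSeq 0 j) =
      ((n : ℂ) + 1) * ((-1) ^ n * ∫ u in Ioi (0 : ℝ), integrand n u) := by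
  have hP : AnalyticAt ℂ gammaProd 0 := analyticAt_gammaProd (by simp) (by simp)
  have hG := analyticAt_mellin_one_sub_zero
  have hZ : AnalyticAt ℂ (fun s => riemannZeta s + 1 / 2) 0 :=
    analyticAt_riemannZeta_zero.add analyticAt_const
  have he : (fun s => s * mellin (integrand 0) (1 - s)) =ᶠ[𝓝 0]
      gammaProd * fun s => riemannZeta s + 1 / 2 := by
    filter_upwards [eventually_re_mem_strip] with s hs
    exact mul_mellin_integrand_zero hs.1 hs.2
  have h := iteratedDeriv_id_mul_zero hG n
  -- The top Leibniz term contains ζ(0) + 1/2 = 0, so the sum stops at k = n.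
  rw [he.iteratedDeriv_eq, iteratedDeriv_mul hP.contDiffAt hZ.contDiffAt,
    Finset.sum_range_succ, iteratedDeriv_mellin_one_sub_zero, Nat.sub_self, iteratedDeriv_zero,
    riemannZeta_zero, neg_div, neg_add_cancel, mul_zero, add_zero] at h
  rw [← h]
  refine Finset.sum_congr rfl fun k hk => ?_
  obtain ⟨i, hi⟩ : ∃ i, n + 1 - k = i + 1 :=
    ⟨n - k, by have := Finset.mem_range.1 hk; omega⟩
  rw [hi, iteratedDeriv_riemannZeta_add, iteratedDeriv_gammaProd_zero]
  ring

end ConnonZeta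

theorem mainTheorem4 :
    -- convergence of all the integrals
    (∀ m : ℕ, MeasureTheory.IntegrableOn (ConnonZeta.integrand m) (Set.Ioi (0 : ℝ))) ∧
    -- the Bell polynomials in terms of zeta values
    (∀ k : ℕ, ConnonZeta.completeBell k (ConnonZeta.psiSeq 0) =
        ConnonZeta.completeBell k ConnonZeta.zetaSeq) ∧
    (∀ k : ℕ, ConnonZeta.completeBell k (fun j => -ConnonZeta.psiSeq 0 j) =
        ConnonZeta.completeBell k (fun j => -ConnonZeta.zetaSeq j)) ∧
    -- the formula for the `n`-th derivative of zeta at `0`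
    (∀ n : ℕ, 1 ≤ n →
      iteratedDeriv n riemannZeta 0 =
        (n : ℂ) * (-1) ^ n *
          ∑ k ∈ Finset.range n,
            ((n - 1).choose k : ℂ) * (-1) ^ (k + 1) *
              ConnonZeta.completeBell k (ConnonZeta.psiSeq 0) *
              ∫ u in Set.Ioi (0 : ℝ), ConnonZeta.integrand (n - k - 1) u) ∧
    -- the companion identity
    (∀ n : ℕ, 1 ≤ n →
      ∑ k ∈ Finset.range n,
          (n.choose k : ℂ) * iteratedDeriv (n - k) riemannZeta 0 *
            ConnonZeta.completeBell k (fun j => -ConnonZeta.psiSeq 0 j) =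
        (n : ℂ) * (-1) ^ (n - 1) *
          ∫ u in Set.Ioi (0 : ℝ), ConnonZeta.integrand (n - 1) u) := by
  refine ⟨ConnonZeta.integrableOn_integrand, fun k => ?_, fun k => ?_, fun n hn => ?_,
    fun n hn => ?_⟩
  · exact ConnonZeta.completeBell_congr fun j hj => ConnonZeta.psiSeq_zero_eq_zetaSeq hj
  · refine ConnonZeta.completeBell_congr fun j hj => ?_
    rw [ConnonZeta.psiSeq_zero_eq_zetaSeq hj]
  · obtain ⟨n, rfl⟩ := Nat.exists_eq_add_of_le' hn
    rw [ConnonZeta.iteratedDeriv_riemannZeta_zero, mul_assoc, Nat.cast_add_one, Nat.add_sub_cancel]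
    congr 1
    rw [Finset.mul_sum]
    refine Finset.sum_congr rfl fun k hk => ?_
    obtain ⟨i, rfl⟩ := Nat.exists_eq_add_of_le (Nat.lt_succ_iff.1 (Finset.mem_range.1 hk))
    have h1 : k + i + 1 - k - 1 = i := by omega
    -- The two sign conventions differ by (-1)^(2k).
    have h2 : ((-1 : ℂ) ^ k) * (-1) ^ k = 1 := by rw [← mul_pow]; simp
    rw [h1, Nat.add_sub_cancel_left]
    linear_combination (-((k + i).choose k : ℂ) * ConnonZeta.completeBell k (ConnonZeta.psiSeq 0) *
      (-1) ^ i * ∫ u in Set.Ioi (0 : ℝ), ConnonZeta.integrand i u) * h2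
  · obtain ⟨n, rfl⟩ := Nat.exists_eq_add_of_le' hn
    rw [ConnonZeta.sum_iteratedDeriv_riemannZeta_zero, Nat.add_sub_cancel, Nat.cast_add_one,
      mul_assoc]
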